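/- Let $m>1$ be an integer and $p$ a prime. There is a finite set $S\subset \mathrm{SL}(m,\mathbb Z_p)\times \mathrm{SL}(m,\mathbb Z_p)$ such that $S$ freely generates a subgroup that is dense (for the $p$-adic topology) and the following holds. For $n\ge 0$ let $S_n$ be the image of $S$ under reduction modulo $p^n$ in $G_n=\mathrm{SL}(m,\mathbb Z/p^n\mathbb Z)\times \mathrm{SL}(m,\mathbb Z/p^n\mathbb Z)$, and let $\mathrm{Cay}(G_n,S_n)$ be the undirected simple graph with vertex set $G_n$ in which distinct $u,v$ are adjacent if and only if $u^{-1}v\in S_n\cup S_n^{-1}$. Then $\mathrm{Cay}(G_n,S_n)$ is connected for every $n$, and its girth (the length of a shortest cycle) tends to infinity as $n\to\infty$. -/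

import Mathlib

/-- The group `SL(m, R) × SL(m, R)`. -/
abbrev SLProd (m : ℕ) (R : Type) [CommRing R] : Type :=
  Matrix.SpecialLinearGroup (Fin m) R × Matrix.SpecialLinearGroup (Fin m) R

/-- Entrywise reduction modulo `p ^ n`, as a group homomorphism
`SL(m, ℤ_p) × SL(m, ℤ_p) → SL(m, ℤ/p^n ℤ) × SL(m, ℤ/p^n ℤ)`. -/
noncomputable def reduceModPow (p : ℕ) [Fact p.Prime] (m n : ℕ) :
    SLProd m ℤ_[p] →* SLProd m (ZMod (p ^ n)) :=
  (Matrix.SpecialLinearGroup.map (PadicInt.toZModPow n)).prodMap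
    (Matrix.SpecialLinearGroup.map (PadicInt.toZModPow n))

/-- The set `S` freely generates the subgroup of `G` that it generates: the homomorphism from the
free group on `S` to `G` that extends the inclusion of `S` is injective. -/
def FreelyGenerates {G : Type} [Group G] (S : Set G) : Prop :=
  Function.Injective (FreeGroup.lift (fun s : S => (s : G)))

/-- The Cayley graph of `SL(m, ℤ/p^n ℤ) × SL(m, ℤ/p^n ℤ)` with respect to the image of `S`:
distinct vertices `u`, `v` are adjacent iff `u⁻¹ v` or `v⁻¹ u` is the reduction of some `s ∈ S`. -/
noncomputable def cayleyModPow (p : ℕ) [Fact p.Prime] (m : ℕ) (S : Set (SLProd m ℤ_[p])) (n : ℕ) :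
    SimpleGraph (SLProd m (ZMod (p ^ n))) :=
  SimpleGraph.mulCayley (reduceModPow p m n '' S)

/-! Start from the pairs (lift q, 1) and (1, lift q), with q running over SL(m, ℤ/p³): they generate
modulo p³. Deform their first coordinates, without changing them modulo p³, until these are free;
freeness in one coordinate suffices.

The deformation is made over `ℤ_[p][X]`: each matrix is flanked by two transvections 1 + X wχ, so
every letter has a rank-one leading coefficient, and general position keeps the leading coefficient
of a reduced word nonzero (`injective_lift_deformation`). A nontrivial word becomes trivial at only
finitely many values of X, so some t in the uncountable set p³ℤ_p preserves freeness
(`exists_mem_injective_lift_eval`).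

Generation modulo p³ propagates to every pⁿ through p-th powers (`exists_mem_reduceModPow_eq`),
which gives density and connectedness. A short cycle is a short reduced word that is trivial modulo
pⁿ; there are finitely many such words, and none stays trivial for large n
(`tendsto_girth_cayleyModPow`). -/

/-! ### Leading coefficients of polynomial matrices, and transvections. -/

section DominantCoefficient

open Polynomial Matrix

variable {R : Type*} [CommRing R] {n : Type*}

/-- Every entry of `M` has degree at most `k`, and `L` is the matrix of coefficients of `X ^ k`. -/
def HasTopCoeff (M : Matrix n n R[X]) (k : ℕ) (L : Matrix n n R) : Prop :=
  ∀ i j, (M i j).natDegree ≤ k ∧ (M i j).coeff k = L i j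

/-- As `k` and `k'` are only degree bounds, `L * L'` may vanish here; its nonvanishing is tracked
separately. -/
theorem HasTopCoeff.mul [Fintype n] {M M' : Matrix n n R[X]} {k k' : ℕ} {L L' : Matrix n n R}
    (h : HasTopCoeff M k L) (h' : HasTopCoeff M' k' L') :
    HasTopCoeff (M * M') (k + k') (L * L') := by
  intro i j
  simp only [Matrix.mul_apply]
  refine ⟨natDegree_sum_le_of_forall_le _ _ fun l _ =>
    natDegree_mul_le_of_le (h i l).1 (h' l j).1, ?_⟩
  rw [finsetSum_coeff]
  refine Finset.sum_congr rfl fun l _ => ?_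
  rw [coeff_mul_add_eq_of_natDegree_le (h i l).1 (h' l j).1, (h i l).2, (h' l j).2]

theorem hasTopCoeff_map_C (M : Matrix n n R) : HasTopCoeff (M.map C) 0 M :=
  fun i j => ⟨by simp, by simp⟩

theorem hasTopCoeff_one_add [DecidableEq n] (N : Matrix n n R) :
    HasTopCoeff (1 + (X : R[X]) • N.map C) 1 N := by
  intro i j
  have h1 : ((1 : Matrix n n R[X]) i j).natDegree = 0 := by
    rw [Matrix.one_apply]; split_ifs <;> simp
  have h2 : ((1 : Matrix n n R[X]) i j).coeff 1 = 0 :=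
    coeff_eq_zero_of_natDegree_lt (by rw [h1]; exact one_pos)
  simp only [Matrix.add_apply, Matrix.smul_apply, Matrix.map_apply, smul_eq_mul]
  refine ⟨natDegree_add_le_of_degree_le (by rw [h1]; exact zero_le_one) ?_, ?_⟩
  · exact (natDegree_mul_le).trans (by simpa using natDegree_X_le)
  · rw [coeff_add, h2, zero_add, X_mul_C, coeff_C_mul, coeff_X_one, mul_one]

theorem not_hasTopCoeff_one [DecidableEq n] {k : ℕ} (hk : 0 < k) {L : Matrix n n R} (hL : L ≠ 0) :
    ¬ HasTopCoeff (1 : Matrix n n R[X]) k L := by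
  intro h
  refine hL (Matrix.ext fun i j => ?_)
  rw [← (h i j).2, Matrix.one_apply, Matrix.zero_apply]
  split_ifs
  · exact coeff_one.trans (if_neg hk.ne')
  · simp

variable [Fintype n] [DecidableEq n]

/-- The transvection `1 + c • u φ` where `φ u = 0`. -/
def elementaryTransvection (u φ : n → R) (h : φ ⬝ᵥ u = 0) (c : R) : SpecialLinearGroup n R :=
  ⟨1 + c • vecMulVec u φ, by
    have h' : c • vecMulVec u φ = vecMulVec (c • u) φ := by
      ext; simp [vecMulVec_apply, mul_assoc]
    rw [h', vecMulVec_eq Unit, det_one_add_replicateCol_mul_replicateRow, dotProduct_smul, h,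
      smul_zero, add_zero]⟩

theorem coe_elementaryTransvection (u φ : n → R) (h : φ ⬝ᵥ u = 0) (c : R) :
    (elementaryTransvection u φ h c : Matrix n n R) = 1 + c • vecMulVec u φ := rfl

theorem elementaryTransvection_inv (u φ : n → R) (h : φ ⬝ᵥ u = 0) (c : R) :
    (elementaryTransvection u φ h c)⁻¹ = elementaryTransvection u φ h (-c) := by
  rw [inv_eq_iff_mul_eq_one]
  apply Subtype.ext
  have : vecMulVec u φ * vecMulVec u φ = 0 := by
    rw [vecMulVec_mul_vecMulVec, h, zero_smul]; ext; simp [vecMulVec_apply]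
  change (1 + c • vecMulVec u φ) * (1 + (-c) • vecMulVec u φ) = 1
  simp [mul_add, add_mul, this]

end DominantCoefficient

/-! ### Free families over `R[X]` and their specializations. -/

section FreeFamily

open Polynomial Matrix

theorem vecMulVec_mul_mul_vecMulVec {R n : Type*} [CommRing R] [Fintype n] (u φ v ψ : n → R) 
    (A : Matrix n n R) :
    vecMulVec u φ * A * vecMulVec v ψ = vecMulVec u ((φ ⬝ᵥ (A *ᵥ v)) • ψ) := by
  rw [vecMulVec_mul, vecMulVec_mul_vecMulVec, dotProduct_mulVec]

variable {R : Type*} [CommRing R] {n : Type*} [Fintype n] [DecidableEq n] {I : Type*}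

/-- Vectors `w` and covectors `χ`, indexed by the letters `I × Bool`, in general position with
respect to each other and to the matrices `e`. -/
structure GeneralPosition (e : I → SpecialLinearGroup n R) (w χ : I × Bool → n → R) : Prop where
  dotProduct_self : ∀ a, χ a ⬝ᵥ w a = 0
  dotProduct_ne : ∀ a b, a ≠ b → χ a ⬝ᵥ w b ≠ 0
  dotProduct_mulVec_ne : ∀ i, χ (i, true) ⬝ᵥ ((e i : Matrix n n R) *ᵥ w (i, false)) ≠ 0
  dotProduct_inv_mulVec_ne :
    ∀ i, χ (i, false) ⬝ᵥ (((e i)⁻¹ : SpecialLinearGroup n R).1 *ᵥ w (i, true)) ≠ 0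

namespace GeneralPosition

variable {e : I → SpecialLinearGroup n R} {w χ : I × Bool → n → R}

/-- The transvection `1 + X • w χ` over `R[X]` attached to a letter. -/
noncomputable def polyTransvection (H : GeneralPosition e w χ) (a : I × Bool) (c : R[X]) :
    SpecialLinearGroup n R[X] :=
  elementaryTransvection (C ∘ w a) (C ∘ χ a)
    (by rw [← RingHom.map_dotProduct, H.dotProduct_self, map_zero]) c

/-- The deformation of `e i` by the two transvections attached to `i`. -/
noncomputable def deformation (H : GeneralPosition e w χ) (i : I) : SpecialLinearGroup n R[X] :=
  H.polyTransvection (i, true) X * SpecialLinearGroup.map C (e i) *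
    H.polyTransvection (i, false) X

theorem hasTopCoeff_polyTransvection (H : GeneralPosition e w χ) (a : I × Bool) :
    HasTopCoeff (H.polyTransvection a X).1 1 (vecMulVec (w a) (χ a)) := by
  have : (H.polyTransvection a X).1 = 1 + (X : R[X]) • (vecMulVec (w a) (χ a)).map C := by
    rw [polyTransvection, coe_elementaryTransvection]
    congr 2; ext; simp [vecMulVec_apply]
  rw [this]
  exact hasTopCoeff_one_add _

theorem hasTopCoeff_polyTransvection_inv (H : GeneralPosition e w χ) (a : I × Bool) :
    HasTopCoeff ((H.polyTransvection a X)⁻¹).1 1 (-vecMulVec (w a) (χ a)) := by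
  have : ((H.polyTransvection a X)⁻¹).1 = 1 + (X : R[X]) • (-vecMulVec (w a) (χ a)).map C := by
    rw [polyTransvection, elementaryTransvection_inv, coe_elementaryTransvection, neg_smul,
      ← smul_neg]
    congr 2; ext; simp [vecMulVec_apply]
  rw [this]
  exact hasTopCoeff_one_add _

/-- The value of a letter of the free group on `I`. -/
noncomputable def letter (H : GeneralPosition e w χ) (a : I × Bool) : SpecialLinearGroup n R[X] :=
  bif a.2 then H.deformation a.1 else (H.deformation a.1)⁻¹

/-- Writing a' for the inverse letter, the leading term is (w_a χ_a) g (w_a' χ_a'), with g = e_i or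
its inverse. The middle collapses to the scalar χ_a g w_a', nonzero by general position. Inversion
reverses the order, and its two signs cancel. -/
theorem exists_hasTopCoeff_letter (H : GeneralPosition e w χ) (a : I × Bool) :
    ∃ c : R, c ≠ 0 ∧
      HasTopCoeff (H.letter a).1 2 (vecMulVec (w a) (c • χ (a.1, !a.2))) := by
  obtain ⟨i, _ | _⟩ := a
  · refine ⟨_, H.dotProduct_inv_mulVec_ne i, ?_⟩
    have := ((H.hasTopCoeff_polyTransvection_inv (i, false)).mul
      (hasTopCoeff_map_C ((e i)⁻¹ : SpecialLinearGroup n R).1)).mul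
      (H.hasTopCoeff_polyTransvection_inv (i, true))
    rw [neg_mul, neg_mul, mul_neg, neg_neg, vecMulVec_mul_mul_vecMulVec] at this
    convert! this using 1
    have hinv : H.letter (i, false) = (H.polyTransvection (i, false) X)⁻¹ *
        SpecialLinearGroup.map C (e i)⁻¹ * (H.polyTransvection (i, true) X)⁻¹ := by
      simp only [letter, deformation, cond_false, _root_.mul_inv_rev, map_inv, mul_assoc]
    rw [hinv]
    rfl
  · refine ⟨_, H.dotProduct_mulVec_ne i, ?_⟩
    have := ((H.hasTopCoeff_polyTransvection (i, true)).mul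
      (hasTopCoeff_map_C (e i).1)).mul (H.hasTopCoeff_polyTransvection (i, false))
    rw [vecMulVec_mul_mul_vecMulVec] at this
    convert! this using 1

variable [IsDomain R]

/-- Prepending a to a word starting with b multiplies the leading term by χ_a' · w_b, which can
vanish only for b = a', the case that reducedness excludes. -/
theorem exists_hasTopCoeff_prod (H : GeneralPosition e w χ) (a : I × Bool)
    (l : List (I × Bool)) (hl : FreeGroup.IsReduced (a :: l)) :
    ∃ φ : n → R, φ ≠ 0 ∧ HasTopCoeff (((a :: l).map H.letter).prod).1 (2 * (l.length + 1))
      (vecMulVec (w a) φ) := by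
  induction l generalizing a with
  | nil =>
    obtain ⟨c, hc, h⟩ := H.exists_hasTopCoeff_letter a
    refine ⟨_, smul_ne_zero hc fun h0 => ?_, by simpa using h⟩
    refine H.dotProduct_ne (a.1, !a.2) a (fun h' => ?_) (by rw [h0, zero_dotProduct])
    simpa using congrArg Prod.snd h'
  | cons b l ih =>
    rw [FreeGroup.isReduced_cons_cons] at hl
    obtain ⟨φ, hφ, h⟩ := ih b hl.2
    obtain ⟨c, hc, h'⟩ := H.exists_hasTopCoeff_letter a
    have hne : χ (a.1, !a.2) ⬝ᵥ w b ≠ 0 := by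
      refine H.dotProduct_ne (a.1, !a.2) b fun hab => ?_
      have h1 : a.2 = b.2 := hl.1 (by rw [← hab])
      have h2 : (!a.2) = b.2 := by rw [← hab]
      simp [← h1] at h2
    have h'' := h'.mul h
    rw [vecMulVec_mul_vecMulVec, smul_dotProduct, smul_eq_mul] at h''
    refine ⟨_, smul_ne_zero (mul_ne_zero hc hne) hφ, ?_⟩
    rw [List.map_cons, List.prod_cons, List.length_cons]
    convert! h'' using 1
    ring

theorem injective_lift_deformation (H : GeneralPosition e w χ) :
    Function.Injective (FreeGroup.lift H.deformation) := by
  classical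
  rw [injective_iff_map_eq_one]
  intro x hx
  rw [← FreeGroup.toWord_eq_nil_iff]
  have hred := FreeGroup.isReduced_toWord (x := x)
  rw [← FreeGroup.mk_toWord (x := x), FreeGroup.lift_mk] at hx
  cases hl : x.toWord with
  | nil => rfl
  | cons a l =>
    rw [hl] at hx hred
    obtain ⟨φ, hφ, h⟩ := H.exists_hasTopCoeff_prod a l hred
    change (List.map H.letter (a :: l)).prod = 1 at hx
    rw [hx] at h
    refine absurd h (not_hasTopCoeff_one (by positivity) fun h0 => ?_)
    have hw : w a ≠ 0 := fun h1 => by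
      refine H.dotProduct_ne (a.1, !a.2) a (fun h' => ?_) (by rw [h1, dotProduct_zero])
      simpa using congrArg Prod.snd h'
    obtain ⟨i, hi⟩ := Function.ne_iff.1 hw
    obtain ⟨j, hj⟩ := Function.ne_iff.1 hφ
    exact mul_ne_zero hi hj (by simpa [vecMulVec_apply] using congrFun (congrFun h0 i) j)

end GeneralPosition

/-- A free family of matrices over `R[X]`, indexed by a countable set, has a free specialization
at some element of any given uncountable set. -/
theorem exists_mem_injective_lift_eval [IsDomain R] [Countable I]
    (h : I → SpecialLinearGroup n R[X]) (hh : Function.Injective (FreeGroup.lift h))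
    {T : Set R} (hT : ¬ T.Countable) :
    ∃ t ∈ T, Function.Injective
      (FreeGroup.lift fun i => SpecialLinearGroup.map (evalRingHom t) (h i)) := by
  classical
  by_contra! hcon
  -- The bad parameters of one word are roots of a nonzero entry of its value minus 1, hence finite
  -- in number; there are countably many words.
  refine hT (Set.Countable.mono (s₂ := ⋃ x ∈ {x : FreeGroup I | x ≠ 1},
    {t : R | SpecialLinearGroup.map (evalRingHom t) (FreeGroup.lift h x) = 1}) ?_ ?_)
  · intro t ht
    have h1 := hcon t ht
    have h2 : FreeGroup.lift (fun i => SpecialLinearGroup.map (evalRingHom t) (h i)) =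
        (SpecialLinearGroup.map (evalRingHom t)).comp (FreeGroup.lift h) := by
      ext i : 1; simp
    rw [h2, injective_iff_map_eq_one] at h1
    push Not at h1
    obtain ⟨x, hx, hx1⟩ := h1
    exact Set.mem_biUnion hx1 hx
  · refine Set.Countable.biUnion (Set.to_countable _) fun x hx => Set.Finite.countable ?_
    have h1 : FreeGroup.lift h x ≠ 1 := fun h0 => hx (hh (h0.trans (map_one _).symm))
    have : ∃ i j, (FreeGroup.lift h x).1 i j ≠ (1 : Matrix n n R[X]) i j := by
      by_contra! h0
      exact h1 (Matrix.SpecialLinearGroup.ext (FreeGroup.lift h x) 1 h0)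
    obtain ⟨i, j, hij⟩ := this
    refine (Polynomial.finite_setOfPred_isRoot (sub_ne_zero.2 hij)).subset fun t ht => ?_
    have h3 := congrFun (congrFun (congrArg Subtype.val (Set.mem_ofPred.1 ht)) i) j
    have h4 : eval t ((FreeGroup.lift h x).1 i j) = (1 : Matrix n n R) i j := h3
    rw [Set.mem_ofPred, IsRoot, eval_sub, h4, Matrix.one_apply, Matrix.one_apply]
    split_ifs <;> simp

end FreeFamily

/-! ### Existence of vectors and covectors in general position. -/

section ExistsGeneralPosition

open Polynomial Matrix

variable {R : Type*} [CommRing R]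

/-- The vector `(1, x, 0, …, 0)`. -/
def planeVector (d : ℕ) (x : R) : Fin (d + 2) → R := Fin.cons 1 (Fin.cons x 0)

/-- The covector `(-x, 1, s, s ^ 2, …)`, which vanishes on `(1, x, 0, …, 0)`. -/
def momentCovector (d : ℕ) (x s : R) : Fin (d + 2) → R := Fin.cons (-x) fun k => s ^ (k : ℕ)

theorem momentCovector_dotProduct (d : ℕ) (x s : R) (v : Fin (d + 2) → R) :
    momentCovector d x s ⬝ᵥ v = -x * v 0 + ∑ k : Fin (d + 1), s ^ (k : ℕ) * v k.succ := by
  simp [dotProduct, Fin.sum_univ_succ, momentCovector]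

theorem momentCovector_dotProduct_planeVector (d : ℕ) (x s y : R) :
    momentCovector d x s ⬝ᵥ planeVector d y = y - x := by
  rw [momentCovector_dotProduct, Fin.sum_univ_succ]
  simp [planeVector]; ring

/-- The pairing is a polynomial in s with coefficients v₁ - x v₀, v₂, v₃, …, which all vanish only
when v = v₀(1, x, 0, …, 0). -/
theorem finite_momentCovector_dotProduct_eq_zero [IsDomain R] (d : ℕ) (x : R)
    (v : Fin (d + 2) → R) (hv : v ≠ v 0 • planeVector d x) :
    {s : R | momentCovector d x s ⬝ᵥ v = 0}.Finite := by
  set P : R[X] := C (-x * v 0) + ∑ k : Fin (d + 1), C (v k.succ) * X ^ (k : ℕ) with hP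
  have hcoeff : ∀ k : Fin (d + 1), P.coeff k = (if (k : ℕ) = 0 then -x * v 0 else 0) + v k.succ := by
    intro k
    rw [hP, coeff_add, finsetSum_coeff, coeff_C]
    congr 1
    rw [Finset.sum_eq_single k]
    · simp
    · intro l _ hl
      rw [coeff_C_mul, coeff_X_pow, if_neg (fun h => hl (Fin.ext h.symm)), mul_zero]
    · simp
  have hP0 : P ≠ 0 := by
    intro h0
    refine hv (funext fun k => ?_)
    refine Fin.cases ?_ (fun k => ?_) k
    · simp [planeVector]
    · have := hcoeff k
      rw [h0, coeff_zero] at this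
      refine Fin.cases (fun h => ?_) (fun k h => ?_) k this
      · simp [planeVector] at h ⊢
        linear_combination -h
      · simp [planeVector] at h ⊢
        exact h.symm
  refine (Polynomial.finite_setOfPred_isRoot hP0).subset fun s hs => ?_
  rw [Set.mem_ofPred, momentCovector_dotProduct] at hs
  rw [Set.mem_ofPred, IsRoot, hP, eval_add, eval_C, eval_finsetSum, ← hs]
  simp only [eval_mul, eval_C, eval_pow, eval_X, mul_comm]

theorem mulVec_mulVec_of_mul_eq_one {n : Type*} [Fintype n] [DecidableEq n]
    {g h : SpecialLinearGroup n R} (hgh : g * h = 1) (v : n → R) : g.1 *ᵥ (h.1 *ᵥ v) = v := by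
  have : g.1 * h.1 = 1 := congrArg Subtype.val hgh
  rw [mulVec_mulVec, this, one_mulVec]

/-- Pairings of letters are differences of the parameters x, so distinct parameters suffice for
them. The conditions involving e_i then exclude finitely many s for each letter. -/
theorem exists_generalPosition [IsDomain R] [Infinite R] {I : Type*} [Finite I] (d : ℕ)
    (e : I → SpecialLinearGroup (Fin (d + 2)) R) :
    ∃ w χ : I × Bool → Fin (d + 2) → R, GeneralPosition e w χ := by
  classical
  obtain ⟨α⟩ : Nonempty (I × Fin 3 ↪ R) := by
    have := Fintype.ofFinite I
    exact ⟨(Fintype.equivFin _).toEmbedding.trans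
      (Fin.valEmbedding.trans (Infinite.natEmbedding R))⟩
  -- Parameter 0 serves (i, false); 1 and 2 are candidates for (i, true). The nonzero vector e_i w
  -- cannot be parallel to both candidates, which are not parallel to each other.
  have key : ∀ i, ∃ k : Fin 3, k ≠ 0 ∧ ∀ c : R, (e i).1 *ᵥ planeVector d (α (i, 0)) ≠
      c • planeVector d (α (i, k)) := by
    intro i
    by_contra! hcon
    obtain ⟨c, hc⟩ := hcon 1 (by decide)
    obtain ⟨c', hc'⟩ := hcon 2 (by decide)
    have h12 := hc.symm.trans hc'
    have h0 : c = c' := by simpa [planeVector] using congrFun h12 0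
    have h1 : c * α (i, 1) = c' * α (i, 2) := by simpa [planeVector] using congrFun h12 1
    have hne : α (i, 1) ≠ α (i, 2) := fun h => by simpa using α.injective h
    rw [← h0] at h1
    have hc0 : c = 0 := by
      by_contra h
      exact hne (mul_left_cancel₀ h h1)
    rw [hc0, zero_smul] at hc
    have := congrArg (fun v => ((e i)⁻¹).1 *ᵥ v) hc
    simp only [mulVec_zero] at this
    rw [mulVec_mulVec_of_mul_eq_one (inv_mul_cancel (e i))] at this
    simpa [planeVector] using congrFun this 0
  choose k hk0 hk using key
  let x : I × Bool → R := fun a => α (a.1, bif a.2 then k a.1 else 0)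
  have hx : Function.Injective x := by
    rintro ⟨i, a⟩ ⟨j, b⟩ hab
    have h := α.injective hab
    simp only [Prod.mk.injEq] at h
    obtain ⟨rfl, h⟩ := h
    have h0 := hk0 i
    cases a <;> cases b
    · rfl
    · exact absurd h.symm h0
    · exact absurd h h0
    · rfl
  let bad : I × Bool → Set R := fun a =>
    {s | momentCovector d (x a) s ⬝ᵥ
      ((bif a.2 then e a.1 else (e a.1)⁻¹).1 *ᵥ planeVector d (x (a.1, !a.2))) = 0}
  have hbad : ∀ a, (bad a).Finite := by
    rintro ⟨i, _ | _⟩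
    · refine finite_momentCovector_dotProduct_eq_zero d _ _ fun h => ?_
      simp only [cond_false, Bool.not_false] at h
      set c := (((e i)⁻¹).1 *ᵥ planeVector d (x (i, true))) 0
      have h2 := congrArg (fun v => (e i).1 *ᵥ v) h
      simp only [mulVec_smul] at h2
      rw [mulVec_mulVec_of_mul_eq_one (mul_inv_cancel (e i))] at h2
      -- First coordinates of plane vectors are 1, so c is invertible in `R` and the relation can be
      -- turned around without a field.
      have h3 : 1 = c * ((e i).1 *ᵥ planeVector d (x (i, false))) 0 := by
        simpa [planeVector] using congrFun h2 0
      refine hk i (((e i).1 *ᵥ planeVector d (x (i, false))) 0) ?_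
      change _ = _ • planeVector d (x (i, true))
      rw [h2, smul_smul, mul_comm, ← h3, one_smul]
      rfl
    · exact finite_momentCovector_dotProduct_eq_zero d _ _ fun h => hk i _ h
  choose s hs using fun a => (hbad a).exists_notMem
  refine ⟨fun a => planeVector d (x a), fun a => momentCovector d (x a) (s a),
    fun a => ?_, fun a b hab => ?_, fun i => hs (i, true), fun i => hs (i, false)⟩
  · rw [momentCovector_dotProduct_planeVector, sub_self]
  · rw [momentCovector_dotProduct_planeVector, sub_ne_zero]
    exact fun h => hab (hx h.symm)

end ExistsGeneralPosition

/-! ### Congruence quotients and lifting of generation from p³ to pⁿ. -/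

section Congruence

open Matrix

variable {p : ℕ} [Fact p.Prime]

theorem toZModPow_eq_iff_dvd {n : ℕ} {x y : ℤ_[p]} :
    PadicInt.toZModPow n x = PadicInt.toZModPow n y ↔ (p : ℤ_[p]) ^ n ∣ x - y := by
  rw [← sub_eq_zero, ← map_sub, ← RingHom.mem_ker, PadicInt.ker_toZModPow,
    Ideal.mem_span_singleton]

theorem map_toZModPow_eq_iff {n m : ℕ} {g h : SpecialLinearGroup (Fin m) ℤ_[p]} :
    SpecialLinearGroup.map (PadicInt.toZModPow n) g =
      SpecialLinearGroup.map (PadicInt.toZModPow n) h ↔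
      ∃ B : Matrix (Fin m) (Fin m) ℤ_[p], g.1 = h.1 + (p : ℤ_[p]) ^ n • B := by
  constructor
  · intro hgh
    have h1 : ∀ i j, ∃ b, g.1 i j - h.1 i j = (p : ℤ_[p]) ^ n * b := fun i j =>
      toZModPow_eq_iff_dvd.1 (congrFun (congrFun (congrArg Subtype.val hgh) i) j)
    choose B hB using h1
    refine ⟨of B, Matrix.ext fun i j => ?_⟩
    change g.1 i j = h.1 i j + (p : ℤ_[p]) ^ n * B i j
    rw [← hB, add_sub_cancel]
  · rintro ⟨B, hB⟩
    refine Matrix.SpecialLinearGroup.ext _ _ fun i j => ?_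
    change PadicInt.toZModPow n (g.1 i j) = PadicInt.toZModPow n (h.1 i j)
    rw [toZModPow_eq_iff_dvd, hB]
    exact ⟨B i j, by simp⟩

theorem toZModPow_eq_of_le {n k : ℕ} (hnk : n ≤ k) {x y : ℤ_[p]}
    (h : PadicInt.toZModPow k x = PadicInt.toZModPow k y) :
    PadicInt.toZModPow n x = PadicInt.toZModPow n y := by
  rw [toZModPow_eq_iff_dvd] at h ⊢
  exact (pow_dvd_pow _ hnk).trans h

theorem reduceModPow_eq_iff {m n : ℕ} {g h : SLProd m ℤ_[p]} :
    reduceModPow p m n g = reduceModPow p m n h ↔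
      SpecialLinearGroup.map (PadicInt.toZModPow n) g.1 =
        SpecialLinearGroup.map (PadicInt.toZModPow n) h.1 ∧
      SpecialLinearGroup.map (PadicInt.toZModPow n) g.2 =
        SpecialLinearGroup.map (PadicInt.toZModPow n) h.2 :=
  Prod.ext_iff

theorem reduceModPow_eq_of_le {m n k : ℕ} (hnk : n ≤ k) {g h : SLProd m ℤ_[p]}
    (hgh : reduceModPow p m k g = reduceModPow p m k h) :
    reduceModPow p m n g = reduceModPow p m n h := by
  rw [reduceModPow_eq_iff] at hgh ⊢
  exact ⟨Matrix.SpecialLinearGroup.ext _ _ fun i j => toZModPow_eq_of_le hnk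
      (congrFun (congrFun (congrArg Subtype.val hgh.1) i) j),
    Matrix.SpecialLinearGroup.ext _ _ fun i j => toZModPow_eq_of_le hnk
      (congrFun (congrFun (congrArg Subtype.val hgh.2) i) j)⟩

theorem isUnit_of_toZModPow_eq_one {n : ℕ} (hn : n ≠ 0) {x : ℤ_[p]}
    (hx : PadicInt.toZModPow n x = 1) : IsUnit x := by
  rw [← map_one (PadicInt.toZModPow n), toZModPow_eq_iff_dvd] at hx
  refine IsLocalRing.isUnit_of_mem_nonunits_one_sub_self x fun h => ?_
  have : IsUnit (p : ℤ_[p]) := by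
    refine isUnit_of_dvd_unit ((dvd_pow_self _ hn).trans hx) ?_
    rw [← neg_sub]; exact h.neg
  exact PadicInt.prime_p.not_isUnit this

/-- An entrywise lift has determinant congruent to 1, hence a unit when n > 0; scaling one row by
its inverse corrects it without affecting the reduction. -/
theorem map_toZModPow_surjective (m n : ℕ) :
    Function.Surjective (SpecialLinearGroup.map (n := Fin m)
      (PadicInt.toZModPow n : ℤ_[p] →+* ZMod (p ^ n))) := by
  intro g
  rcases eq_or_ne n 0 with rfl | hn
  · have : Subsingleton (ZMod (p ^ 0)) := by rw [pow_zero]; infer_instance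
    exact ⟨1, Matrix.SpecialLinearGroup.ext _ _ fun i j => Subsingleton.elim _ _⟩
  rcases m with _ | m
  · exact ⟨1, Matrix.SpecialLinearGroup.ext _ _ fun i => i.elim0⟩
  choose r hr using ZMod.ringHom_surjective (PadicInt.toZModPow n : ℤ_[p] →+* ZMod (p ^ n))
  let M : Matrix (Fin (m + 1)) (Fin (m + 1)) ℤ_[p] := of fun i j => r (g.1 i j)
  have hM : (PadicInt.toZModPow n).mapMatrix M = g.1 := Matrix.ext fun i j => hr _
  have hdet : PadicInt.toZModPow n M.det = 1 := by
    rw [RingHom.map_det, hM, g.2]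
  obtain ⟨u, hu⟩ := isUnit_of_toZModPow_eq_one hn hdet
  have hu' : PadicInt.toZModPow n (↑u⁻¹ : ℤ_[p]) = 1 := by
    have := congrArg (PadicInt.toZModPow n) u.inv_mul
    rwa [map_mul, hu, hdet, mul_one, map_one] at this
  refine ⟨⟨M.updateRow 0 ((↑u⁻¹ : ℤ_[p]) • M 0), ?_⟩, Matrix.SpecialLinearGroup.ext _ _ fun i j => ?_⟩
  · rw [det_updateRow_smul, updateRow_eq_self, ← hu, u.inv_mul]
  · change PadicInt.toZModPow n (M.updateRow 0 ((↑u⁻¹ : ℤ_[p]) • M 0) i j) = g.1 i j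
    rw [updateRow_apply]
    split_ifs with h
    · rw [Pi.smul_apply, smul_eq_mul, map_mul, hu', one_mul, h]; exact hr _
    · exact hr _

theorem reduceModPow_surjective (m n : ℕ) : Function.Surjective (reduceModPow p m n) :=
  Function.Surjective.prodMap (map_toZModPow_surjective m n) (map_toZModPow_surjective m n)

theorem exists_one_add_smul_pow {R A : Type*} [CommRing R] [Ring A] [Algebra R A] (c : R) (a : A)
    (k : ℕ) : ∃ b : A, (1 + c • a) ^ k = 1 + (k * c) • a + (c ^ 2) • b := by
  induction k with
  | zero => exact ⟨0, by simp⟩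
  | succ k ih =>
    obtain ⟨b, hb⟩ := ih
    refine ⟨(k : R) • (a * a) + b + c • (b * a), ?_⟩
    rw [pow_succ, hb]
    simp only [mul_add, add_mul, mul_one, one_mul, smul_mul_assoc, mul_smul_comm, smul_add,
      smul_smul]
    push_cast
    module

/-- An element congruent to `1` modulo `p ^ (k + 1)` is, modulo `p ^ (k + 2)`, a `p`-th power of
any element in a suitable residue class modulo `p ^ (k + 1)`. -/
theorem exists_pow_eq_of_map_eq_one {m k : ℕ} (hk : 2 ≤ k)
    (y : SpecialLinearGroup (Fin m) ℤ_[p])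
    (hy : SpecialLinearGroup.map (PadicInt.toZModPow (k + 1)) y = 1) :
    ∃ y' : SpecialLinearGroup (Fin m) ℤ_[p], ∀ h : SpecialLinearGroup (Fin m) ℤ_[p],
      SpecialLinearGroup.map (PadicInt.toZModPow (k + 1)) h =
        SpecialLinearGroup.map (PadicInt.toZModPow (k + 1)) y' →
      SpecialLinearGroup.map (PadicInt.toZModPow (k + 2)) (h ^ p) =
        SpecialLinearGroup.map (PadicInt.toZModPow (k + 2)) y := by
  rw [← map_one (SpecialLinearGroup.map (PadicInt.toZModPow (k + 1))), map_toZModPow_eq_iff] at hy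
  obtain ⟨A, hA⟩ := hy
  have hA' : y.1 = 1 + (p : ℤ_[p]) ^ (k + 1) • A := hA
  have hp0 : (p : ℤ_[p]) ≠ 0 := by exact_mod_cast (Fact.out : p.Prime).ne_zero
  -- Expanding det y = 1 to first order shows that p^(k+1) divides tr A, so 1 + p^k A can be
  -- corrected to determinant 1 modulo p^(k+1).
  have hdet : PadicInt.toZModPow (k + 1) (det (1 + (p : ℤ_[p]) ^ k • A)) = 1 := by
    have h1 := y.2
    rw [hA', det_one_add_smul] at h1
    rw [det_one_add_smul, ← map_one (PadicInt.toZModPow (k + 1)), toZModPow_eq_iff_dvd]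
    generalize Polynomial.eval ((p : ℤ_[p]) ^ (k + 1)) _ = c at h1
    generalize Polynomial.eval ((p : ℤ_[p]) ^ k) _ = c'
    have h2 : A.trace = -(c * p ^ (k + 1)) := by
      have h3 : (p : ℤ_[p]) ^ (k + 1) * (A.trace + c * p ^ (k + 1)) = 0 := by
        linear_combination h1
      linear_combination (mul_eq_zero.1 h3).resolve_left (pow_ne_zero _ hp0)
    obtain ⟨j, rfl⟩ := Nat.exists_eq_add_of_le hk
    exact ⟨-(c * p ^ (2 + j)) + c' * p ^ (1 + j), by rw [h2]; ring⟩
  obtain ⟨y', hy'⟩ := map_toZModPow_surjective m (k + 1)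
    (⟨(PadicInt.toZModPow (k + 1)).mapMatrix (1 + (p : ℤ_[p]) ^ k • A), by
      rw [← RingHom.map_det, hdet]⟩ : SpecialLinearGroup (Fin m) (ZMod (p ^ (k + 1))))
  refine ⟨y', fun h hh => ?_⟩
  rw [hy'] at hh
  have h1 : ∀ i j, ∃ b, h.1 i j - (1 + (p : ℤ_[p]) ^ k • A) i j = (p : ℤ_[p]) ^ (k + 1) * b :=
    fun i j => toZModPow_eq_iff_dvd.1 (congrFun (congrFun (congrArg Subtype.val hh) i) j)
  choose B hB using h1
  have hh' : h.1 = 1 + (p : ℤ_[p]) ^ k • (A + (p : ℤ_[p]) • of B) := by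
    ext i j
    have := hB i j
    simp only [Matrix.add_apply, Matrix.smul_apply, smul_eq_mul, of_apply] at this ⊢
    linear_combination this
  obtain ⟨D, hD⟩ := exists_one_add_smul_pow ((p : ℤ_[p]) ^ k) (A + (p : ℤ_[p]) • of B) p
  rw [map_toZModPow_eq_iff]
  obtain ⟨j, rfl⟩ := Nat.exists_eq_add_of_le hk
  -- The error p^(2k) D is absorbed modulo p^(k+2) because k ≥ 2; this is why p³ is the starting
  -- level, uniformly in p.
  refine ⟨of B + ((p : ℤ_[p]) ^ j) • D, ?_⟩
  rw [hA']
  change h.1 ^ p = _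
  rw [hh', hD]
  module

/-- Frattini-type induction: the error h₀⁻¹g is, one level higher, a p-th power whose base matters
only at the current level, so that base can be taken in `H`. -/
theorem exists_mem_reduceModPow_eq {m : ℕ} (H : Subgroup (SLProd m ℤ_[p]))
    (hH : ∀ g, ∃ h ∈ H, reduceModPow p m 3 h = reduceModPow p m 3 g) (n : ℕ)
    (g : SLProd m ℤ_[p]) : ∃ h ∈ H, reduceModPow p m n h = reduceModPow p m n g := by
  have key : ∀ k, ∀ g, ∃ h ∈ H, reduceModPow p m (k + 3) h = reduceModPow p m (k + 3) g := by
    intro k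
    induction k with
    | zero => exact hH
    | succ k ih =>
      intro g
      obtain ⟨h₀, hh₀, e₀⟩ := ih g
      have hy : reduceModPow p m (k + 3) (h₀⁻¹ * g) = 1 := by
        rw [map_mul, map_inv, e₀, inv_mul_cancel]
      obtain ⟨y₁, hy₁⟩ := exists_pow_eq_of_map_eq_one (k := k + 2) (by omega) (h₀⁻¹ * g).1
        (congrArg Prod.fst hy)
      obtain ⟨y₂, hy₂⟩ := exists_pow_eq_of_map_eq_one (k := k + 2) (by omega) (h₀⁻¹ * g).2
        (congrArg Prod.snd hy)
      obtain ⟨h, hh, e⟩ := ih (y₁, y₂)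
      rw [reduceModPow_eq_iff] at e
      refine ⟨h₀ * h ^ p, H.mul_mem hh₀ (H.pow_mem hh p), ?_⟩
      have : reduceModPow p m (k + 1 + 3) (h ^ p) = reduceModPow p m (k + 1 + 3) (h₀⁻¹ * g) :=
        reduceModPow_eq_iff.2 ⟨hy₁ h.1 e.1, hy₂ h.2 e.2⟩
      rw [map_mul, this, ← map_mul, mul_inv_cancel_left]
  obtain ⟨h, hh, e⟩ := key n g
  exact ⟨h, hh, reduceModPow_eq_of_le (by omega) e⟩

theorem tendsto_of_map_toZModPow_eq {m : ℕ} {u : ℕ → SpecialLinearGroup (Fin m) ℤ_[p]}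
    {g : SpecialLinearGroup (Fin m) ℤ_[p]}
    (h : ∀ n, SpecialLinearGroup.map (PadicInt.toZModPow n) (u n) =
      SpecialLinearGroup.map (PadicInt.toZModPow n) g) :
    Filter.Tendsto u Filter.atTop (nhds g) := by
  refine tendsto_subtype_rng.2 (tendsto_pi_nhds.2 fun i => tendsto_pi_nhds.2 fun j => ?_)
  rw [tendsto_iff_norm_sub_tendsto_zero]
  have hp : (1 : ℝ) < p := by exact_mod_cast (Fact.out : p.Prime).one_lt
  refine squeeze_zero (fun n => norm_nonneg _) (fun n => ?_)
    (tendsto_pow_atTop_nhds_zero_of_lt_one (inv_nonneg.2 (zero_le_one.trans hp.le))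
      (inv_lt_one_of_one_lt₀ hp))
  have h1 : (p : ℤ_[p]) ^ n ∣ (u n).1 i j - g.1 i j :=
    toZModPow_eq_iff_dvd.1 (congrFun (congrFun (congrArg Subtype.val (h n)) i) j)
  have h2 := (PadicInt.norm_le_pow_iff_mem_span_pow _ n).2 (Ideal.mem_span_singleton.2 h1)
  rwa [_root_.zpow_neg, zpow_natCast, ← inv_pow] at h2

theorem dense_of_reduceModPow_surjOn {m : ℕ} (H : Subgroup (SLProd m ℤ_[p]))
    (hH : ∀ g, ∃ h ∈ H, reduceModPow p m 3 h = reduceModPow p m 3 g) :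
    Dense (H : Set (SLProd m ℤ_[p])) := by
  intro g
  choose u hu e using fun n => exists_mem_reduceModPow_eq H hH n g
  refine mem_closure_of_tendsto (f := u) (b := Filter.atTop) ?_ (Filter.Eventually.of_forall hu)
  rw [← Prod.mk.eta (p := g)]
  exact (tendsto_of_map_toZModPow_eq fun n => (reduceModPow_eq_iff.1 (e n)).1).prodMk_nhds
    (tendsto_of_map_toZModPow_eq fun n => (reduceModPow_eq_iff.1 (e n)).2)

theorem eventually_reduceModPow_ne_one {m : ℕ} {g : SLProd m ℤ_[p]} (hg : g ≠ 1) :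
    ∀ᶠ n in Filter.atTop, reduceModPow p m n g ≠ 1 := by
  by_contra hcon
  refine hg ?_
  have hall : ∀ n, reduceModPow p m n g = reduceModPow p m n 1 := by
    intro n
    obtain ⟨k, hk, h⟩ := Filter.frequently_atTop.1 hcon n
    exact reduceModPow_eq_of_le hk (h.trans (map_one _).symm)
  refine Prod.ext (Matrix.SpecialLinearGroup.ext _ _ fun i j => ?_)
    (Matrix.SpecialLinearGroup.ext _ _ fun i j => ?_)
  · exact PadicInt.ext_of_toZModPow.1 fun n =>
      congrFun (congrFun (congrArg Subtype.val (reduceModPow_eq_iff.1 (hall n)).1) i) j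
  · exact PadicInt.ext_of_toZModPow.1 fun n =>
      congrFun (congrFun (congrArg Subtype.val (reduceModPow_eq_iff.1 (hall n)).2) i) j

end Congruence

/-! ### Cayley graphs, cycles and reduced words. -/

section CayleyGraph

open SimpleGraph

variable {G : Type*} [Group G]

theorem connected_mulCayley_of_closure_eq_top {S : Set G} (hS : Subgroup.closure S = ⊤) :
    (mulCayley S).Connected := by
  have key : ∀ g ∈ Subgroup.closure S, ∀ u, (mulCayley S).Reachable u (u * g) := by
    intro g hg
    induction hg using Subgroup.closure_induction with
    | mem x hx =>
      intro u
      by_cases h : u = u * x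
      · rw [← h]
      · exact Adj.reachable ((mulCayley_adj S _ _).2 ⟨h, Or.inl (by rwa [inv_mul_cancel_left])⟩)
    | one => intro u; rw [mul_one]
    | mul x y _ _ hx hy =>
      intro u
      rw [← mul_assoc]
      exact (hx u).trans (hy _)
    | inv x _ hx =>
      intro u
      simpa using (hx (u * x⁻¹)).symm
  refine (connected_iff _).2 ⟨fun u v => ?_, ⟨1⟩⟩
  have := key (u⁻¹ * v) (by rw [hS]; trivial) u
  rwa [mul_inv_cancel_left] at this

/-- A finite nontrivial tree has a leaf v, yet vs and vt are two distinct neighbours of v. -/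
theorem not_isAcyclic_mulCayley [Finite G] {S : Set G} (hS : Subgroup.closure S = ⊤) {s t : G}
    (hs : s ∈ S) (ht : t ∈ S) (hs1 : s ≠ 1) (ht1 : t ≠ 1) (hst : s ≠ t) :
    ¬ (mulCayley S).IsAcyclic := by
  classical
  have := Fintype.ofFinite G
  have : Nontrivial G := ⟨s, 1, hs1⟩
  intro hac
  obtain ⟨v, hv⟩ := (IsTree.mk (connected_mulCayley_of_closure_eq_top hS)
    hac).exists_vert_degree_one_of_nontrivial
  obtain ⟨x, hx⟩ := Finset.card_eq_one.1 hv
  have key : ∀ g ∈ S, g ≠ 1 → v * g = x := fun g hg hg1 => by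
    rw [← Finset.mem_singleton, ← hx, mem_neighborFinset, mulCayley_adj]
    exact ⟨fun h => hg1 (by simpa using h.symm), Or.inl (by rwa [inv_mul_cancel_left])⟩
  exact hst (mul_left_cancel ((key s hs hs1).trans (key t ht ht1).symm))

/-- The absence of backtracking is what becomes reducedness of the word of labels. -/
theorem SimpleGraph.Walk.IsPath.isChain_darts {V : Type*} {Γ : SimpleGraph V} {u v : V}
    {w : Γ.Walk u v} (hw : w.IsPath) :
    w.darts.IsChain fun d d' => d.snd = d'.fst ∧ d.fst ≠ d'.snd := by
  induction w with
  | nil => exact List.isChain_nil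
  | cons h q ih =>
    rw [Walk.cons_isPath_iff] at hw
    cases q with
    | nil => exact List.isChain_singleton _
    | cons h' q' =>
      refine List.isChain_cons_cons.2 ⟨⟨rfl, fun he => hw.2 ?_⟩, ih hw.1⟩
      simp only at he
      rw [he]
      simp

theorem SimpleGraph.Walk.IsCycle.isChain_darts {V : Type*} {Γ : SimpleGraph V} {u : V}
    {w : Γ.Walk u u} (hw : w.IsCycle) :
    w.darts.IsChain fun d d' => d.snd = d'.fst ∧ d.fst ≠ d'.snd := by
  cases w with
  | nil => exact List.isChain_nil
  | cons h q =>
    rw [Walk.cons_isCycle_iff] at hw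
    have hq := hw.1.isChain_darts
    cases q with
    | nil => exact List.isChain_singleton _
    | cons h' q' =>
      -- Backtracking at the start would reuse the first edge of the cycle.
      refine List.isChain_cons_cons.2 ⟨⟨rfl, fun he => hw.2 ?_⟩, hq⟩
      simp only at he
      simp [he, Sym2.eq_swap]

theorem prod_map_darts {Γ : SimpleGraph G} {u v : G} (w : Γ.Walk u v) :
    (w.darts.map fun d => d.fst⁻¹ * d.snd).prod = u⁻¹ * v := by
  induction w with
  | nil => simp
  | cons h q ih => rw [Walk.darts_cons, List.map_cons, List.prod_cons, ih]; group

/-- A cycle in a Cayley graph gives a reduced word of the same length with trivial value. -/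
theorem exists_isReduced_of_isCycle {I : Type*} (f : I → G) {u : G}
    {w : (mulCayley (Set.range f)).Walk u u} (hw : w.IsCycle) :
    ∃ l : List (I × Bool), l.length = w.length ∧ FreeGroup.IsReduced l ∧
      FreeGroup.lift f (FreeGroup.mk l) = 1 := by
  have key : ∀ d : (mulCayley (Set.range f)).Dart, ∃ a : I × Bool,
      (bif a.2 then f a.1 else (f a.1)⁻¹) = d.fst⁻¹ * d.snd := by
    intro d
    obtain ⟨-, ⟨i, hi⟩ | ⟨i, hi⟩⟩ := (mulCayley_adj _ _ _).1 d.adj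
    · exact ⟨(i, true), hi⟩
    · refine ⟨(i, false), ?_⟩
      rw [cond_false, hi, mul_inv_rev, inv_inv]
  choose a ha using key
  refine ⟨w.darts.map a, by simp, ?_, ?_⟩
  · rw [FreeGroup.IsReduced, List.isChain_map]
    refine hw.isChain_darts.imp fun d d' hd h1 => ?_
    by_contra h2
    -- Cancelling consecutive letters would force the walk to backtrack.
    have h3 : (d.fst⁻¹ * d.snd) * (d'.fst⁻¹ * d'.snd) = 1 := by
      rw [← ha, ← ha, h1]
      cases hb : (a d).2 <;> cases hb' : (a d').2 <;> simp_all
    rw [← hd.1, mul_assoc, mul_inv_cancel_left] at h3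
    exact hd.2 (inv_mul_eq_one.1 h3)
  · rw [FreeGroup.lift_mk, List.map_map]
    have : ((fun x : I × Bool => bif x.2 then f x.1 else (f x.1)⁻¹) ∘ a) =
        fun d => d.fst⁻¹ * d.snd := funext ha
    rw [this, prod_map_darts, inv_mul_cancel]

theorem freelyGenerates_range {I G : Type} [Group G] {f : I → G}
    (hf : Function.Injective (FreeGroup.lift f)) : FreelyGenerates (Set.range f) := by
  have hf' : Function.Injective f := fun i j hij =>
    FreeGroup.of_injective (hf (by simpa using hij))
  let E := Equiv.ofInjective f hf'
  have h1 : FreeGroup.lift (fun s : Set.range f => (s : G)) =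
      (FreeGroup.lift f).comp (FreeGroup.freeGroupCongr E.symm).toMonoidHom := by
    ext s
    obtain ⟨i, rfl⟩ := E.surjective s
    simp [E]
  rw [FreelyGenerates, h1]
  exact hf.comp (FreeGroup.freeGroupCongr E.symm).injective

end CayleyGraph

/-! ### Growth of the girth. -/

section Girth

open SimpleGraph

/-- If the reductions of a finite free family of at least two elements generate the finite
quotients, then the girths of the Cayley graphs tend to infinity. -/
theorem tendsto_girth_cayleyModPow {p : ℕ} [Fact p.Prime] {m : ℕ} {I : Type} [Finite I]
    [Nontrivial I] (f : I → SLProd m ℤ_[p]) (hf : Function.Injective (FreeGroup.lift f))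
    (hgen : ∀ n, Subgroup.closure (reduceModPow p m n '' Set.range f) = ⊤) :
    Filter.Tendsto (fun n : ℕ => (cayleyModPow p m (Set.range f) n).girth)
      Filter.atTop Filter.atTop := by
  refine Filter.tendsto_atTop.2 fun L => ?_
  have hwords : ∀ᶠ n in Filter.atTop, ∀ l ∈ {l : List (I × Bool) | l.length < L},
      l ≠ [] → FreeGroup.IsReduced l →
      reduceModPow p m n (FreeGroup.lift f (FreeGroup.mk l)) ≠ 1 := by
    refine (Filter.eventually_all_finite (List.finite_length_lt _ L)).2 fun l _ => ?_
    by_cases h : l ≠ [] ∧ FreeGroup.IsReduced l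
    · have hne : FreeGroup.lift f (FreeGroup.mk l) ≠ 1 := fun h0 => h.1 <| by
        classical
        have h1 : FreeGroup.mk l = 1 := hf (h0.trans (map_one _).symm)
        rw [← FreeGroup.toWord_eq_nil_iff, FreeGroup.toWord_mk, h.2.reduce_eq] at h1
        exact h1
      filter_upwards [eventually_reduceModPow_ne_one hne] with n hn _ _ using hn
    · exact Filter.Eventually.of_forall fun n h1 h2 => absurd ⟨h1, h2⟩ h
  obtain ⟨i, j, hij⟩ := exists_pair_ne I
  have hf' : Function.Injective f := fun i j hij =>
    FreeGroup.of_injective (hf (by simpa using hij))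
  have hf1 : ∀ i, f i ≠ 1 := fun i hi =>
    FreeGroup.of_ne_one i (hf (by simpa using hi))
  filter_upwards [hwords, eventually_reduceModPow_ne_one (hf1 i),
    eventually_reduceModPow_ne_one (hf1 j),
    eventually_reduceModPow_ne_one (mt inv_mul_eq_one.1 (hf'.ne hij))] with n hn hi hj hij'
  have : Finite (SLProd m (ZMod (p ^ n))) := by
    have : NeZero (p ^ n) := ⟨pow_ne_zero _ (Fact.out : p.Prime).ne_zero⟩
    infer_instance
  -- Needed because `girth` takes the value 0 on acyclic graphs.
  have hac : ¬ (cayleyModPow p m (Set.range f) n).IsAcyclic :=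
    not_isAcyclic_mulCayley (hgen n) (Set.mem_image_of_mem _ ⟨i, rfl⟩)
      (Set.mem_image_of_mem _ ⟨j, rfl⟩) hi hj fun h => hij' <| by
        rw [map_mul, map_inv, h, inv_mul_cancel]
  obtain ⟨u, w, hw, hg⟩ := exists_girth_eq_length.2 hac
  rw [hg]
  by_contra! hlt
  have hrange : reduceModPow p m n '' Set.range f = Set.range (reduceModPow p m n ∘ f) :=
    (Set.range_comp _ _).symm
  have hcyc : ∃ l : List (I × Bool), l.length = w.length ∧ FreeGroup.IsReduced l ∧
      FreeGroup.lift (reduceModPow p m n ∘ f) (FreeGroup.mk l) = 1 := by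
    clear hg hlt
    revert w
    rw [cayleyModPow, hrange]
    intro w hw
    exact exists_isReduced_of_isCycle _ hw
  obtain ⟨l, hl, hred, h1⟩ := hcyc
  refine hn l (by simpa [hl] using hlt) (fun h0 => ?_) hred ?_
  · have := hw.three_le_length
    rw [← hl, h0] at this
    simp at this
  · rw [← h1]
    have : FreeGroup.lift (reduceModPow p m n ∘ f) =
        (reduceModPow p m n).comp (FreeGroup.lift f) := by ext i : 1; simp
    rw [this]; rfl

end Girth

/-! ### Choice of the parameter and assembly of the generators. -/

section Main

open Matrix Polynomial

/-- Multiplication by p^k embeds ℤ_p in this set, and a countable ℤ_p would have a countable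
fraction field ℚ_p. -/
theorem not_countable_setOf_dvd (p : ℕ) [Fact p.Prime] (k : ℕ) :
    ¬ {t : ℤ_[p] | (p : ℤ_[p]) ^ k ∣ t}.Countable := by
  intro h
  have hp0 : (p : ℤ_[p]) ^ k ≠ 0 :=
    pow_ne_zero _ (by exact_mod_cast (Fact.out : p.Prime).ne_zero)
  have h1 : Countable ℤ_[p] := by
    refine Set.countable_univ_iff.1 ((h.preimage (mul_right_injective₀ hp0)).mono fun x _ => ?_)
    exact Dvd.intro x rfl
  have h2 : Countable ℚ_[p] := by
    refine Function.Surjective.countable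
      (f := fun x : ℤ_[p] × ℤ_[p] => (x.1 : ℚ_[p]) / (x.2 : ℚ_[p])) fun z => ?_
    obtain ⟨x, y, -, h⟩ := IsFractionRing.div_surjective (A := ℤ_[p]) z
    exact ⟨(x, y), h⟩
  exact absurd (Cardinal.mk_le_aleph0_iff.2 h2) (not_le.2 (Cardinal.aleph0_lt_continuum.trans_le
    (continuum_le_cardinal_of_nontriviallyNormedField ℚ_[p])))

theorem map_eval_deformation {p : ℕ} [Fact p.Prime] {m : ℕ} {I : Type*}
    {e : I → SpecialLinearGroup (Fin m) ℤ_[p]} {w χ : I × Bool → Fin m → ℤ_[p]}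
    (H : GeneralPosition e w χ) {k : ℕ} {t : ℤ_[p]} (ht : (p : ℤ_[p]) ^ k ∣ t) (i : I) :
    SpecialLinearGroup.map (PadicInt.toZModPow k)
      (SpecialLinearGroup.map (evalRingHom t) (H.deformation i)) =
      SpecialLinearGroup.map (PadicInt.toZModPow k) (e i) := by
  have h1 : ∀ a, SpecialLinearGroup.map (PadicInt.toZModPow k)
      (SpecialLinearGroup.map (evalRingHom t) (H.polyTransvection a X)) = 1 := by
    intro a
    have ht' : PadicInt.toZModPow k t = 0 := by
      rw [← map_zero (PadicInt.toZModPow k), toZModPow_eq_iff_dvd, sub_zero]; exact ht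
    refine Matrix.SpecialLinearGroup.ext _ _ fun i j => ?_
    change PadicInt.toZModPow k (eval t ((1 : Matrix (Fin m) (Fin m) ℤ_[p][X]) i j +
      X * (C (w a i) * C (χ a j)))) = (1 : Matrix (Fin m) (Fin m) (ZMod (p ^ k))) i j
    rw [eval_add, eval_mul, eval_X, map_add, map_mul, ht', zero_mul, add_zero, Matrix.one_apply,
      Matrix.one_apply]
    split_ifs <;> simp
  have h2 : SpecialLinearGroup.map (evalRingHom t) (SpecialLinearGroup.map C (e i)) = e i :=
    Matrix.SpecialLinearGroup.ext _ _ fun i' j' => eval_C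
  rw [GeneralPosition.deformation, map_mul, map_mul, map_mul, map_mul, h1, h1, h2, one_mul, mul_one]

end Main

theorem mainTheorem1 (p : ℕ) [Fact p.Prime] (m : ℕ) (hm : 1 < m) :
    ∃ S : Set (SLProd m ℤ_[p]), S.Finite ∧
      FreelyGenerates S ∧
      Dense (Subgroup.closure S : Set (SLProd m ℤ_[p])) ∧
      (∀ n : ℕ, (cayleyModPow p m S n).Connected) ∧
      Filter.Tendsto (fun n : ℕ => (cayleyModPow p m S n).girth) Filter.atTop Filter.atTop := by
  obtain ⟨d, rfl⟩ : ∃ d, m = d + 2 := ⟨m - 2, by omega⟩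
  let Q := Matrix.SpecialLinearGroup (Fin (d + 2)) (ZMod (p ^ 3))
  have : NeZero (p ^ 3) := ⟨pow_ne_zero _ (Fact.out : p.Prime).ne_zero⟩
  have : Finite Q := inferInstanceAs (Finite (Matrix.SpecialLinearGroup _ _))
  have hsurj : Function.Surjective (Matrix.SpecialLinearGroup.map (n := Fin (d + 2))
      (PadicInt.toZModPow 3 : ℤ_[p] →+* ZMod (p ^ 3))) := map_toZModPow_surjective _ 3
  choose lift hlift using hsurj
  let e : Q ⊕ Q → Matrix.SpecialLinearGroup (Fin (d + 2)) ℤ_[p] := Sum.elim lift 1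
  let e' : Q ⊕ Q → Matrix.SpecialLinearGroup (Fin (d + 2)) ℤ_[p] := Sum.elim 1 lift
  obtain ⟨w, χ, H⟩ := exists_generalPosition d e
  obtain ⟨t, ht, hfree⟩ := exists_mem_injective_lift_eval H.deformation
    H.injective_lift_deformation (not_countable_setOf_dvd p 3)
  -- All first coordinates are deformed, including those with `e i = 1`, so the projection to the
  -- first factor is already free.
  let f : Q ⊕ Q → SLProd (d + 2) ℤ_[p] := fun i =>
    (Matrix.SpecialLinearGroup.map (Polynomial.evalRingHom t) (H.deformation i), e' i)
  have hf : Function.Injective (FreeGroup.lift f) := by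
    have h1 : (MonoidHom.fst _ _).comp (FreeGroup.lift f) = FreeGroup.lift fun i =>
        Matrix.SpecialLinearGroup.map (Polynomial.evalRingHom t) (H.deformation i) := by
      ext i : 1; simp [f]
    refine Function.Injective.of_comp (f := MonoidHom.fst _ _) ?_
    rw [← MonoidHom.coe_comp, h1]
    exact hfree
  have hred : ∀ i, reduceModPow p (d + 2) 3 (f i) = reduceModPow p (d + 2) 3 (e i, e' i) :=
    fun i => reduceModPow_eq_iff.2 ⟨map_eval_deformation H ht i, rfl⟩
  have hmod : ∀ g, ∃ h ∈ Subgroup.closure (Set.range f),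
      reduceModPow p (d + 2) 3 h = reduceModPow p (d + 2) 3 g := by
    rintro ⟨g₁, g₂⟩
    refine ⟨f (.inl (Matrix.SpecialLinearGroup.map (PadicInt.toZModPow 3) g₁)) *
      f (.inr (Matrix.SpecialLinearGroup.map (PadicInt.toZModPow 3) g₂)),
      Subgroup.mul_mem _ (Subgroup.subset_closure ⟨_, rfl⟩)
        (Subgroup.subset_closure ⟨_, rfl⟩), ?_⟩
    rw [map_mul, hred, hred, ← map_mul]
    refine reduceModPow_eq_iff.2 ⟨?_, ?_⟩
    · simp [e, hlift]
    · simp [e', hlift]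
  have hgen : ∀ n, Subgroup.closure (reduceModPow p (d + 2) n '' Set.range f) = ⊤ := by
    intro n
    rw [← MonoidHom.map_closure, eq_top_iff]
    intro x _
    obtain ⟨g, rfl⟩ := reduceModPow_surjective (d + 2) n x
    exact exists_mem_reduceModPow_eq _ hmod n g
  have : Nontrivial (Q ⊕ Q) := ⟨.inl 1, .inr 1, by simp⟩
  exact ⟨Set.range f, Set.finite_range f, freelyGenerates_range hf,
    dense_of_reduceModPow_surjOn _ hmod,
    fun n => connected_mulCayley_of_closure_eq_top (hgen n),
    tendsto_girth_cayleyModPow f hf hgen⟩
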